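/- Let $\mathcal H$ be a real Hilbert space, let $g\in\mathbb N$, and write $SM_n(\mathbb R)^g$ for the set of $g$-tuples of real symmetric $n\times n$ matrices. Let $A=(A_1,\dots,A_g)$ be a $g$-tuple of compact self-adjoint operators on $\mathcal H$. For $X\in SM_n(\mathbb R)^g$ put $$L_A(X)=I_{\mathcal H}\otimes I_n-\sum_{i=1}^g A_i\otimes X_i$$ on $\mathcal H\otimes\mathbb R^n$, let $\mathcal D_A(n)=\{X\in SM_n(\mathbb R)^g: L_A(X)\succeq 0\}$ and $\mathcal D_A=\bigcup_{n\ge 1}\mathcal D_A(n)$ (a generalized free spectrahedron). Assume that $\mathcal D_A$ is bounded, i.e. there is a real $C$ with $C I_n-\sum_{i=1}^g X_i^2\succeq 0$ for all $n\ge 1$ and all $X\in\mathcal D_A(n)$. For $X\in\mathcal D_A(n)$: * $X$ is an *Arveson extreme point* of $\mathcal D_A$ if for every $\ell\ge 1$, $\beta\in M_{n\times\ell}(\mathbb R)^g$ and $\gamma\in SM_\ell(\mathbb R)^g$ with $\begin{pmatrix}X&\beta\\ \beta^*&\gamma\end{pmatrix}\in\mathcal D_A(n+\ell)$ one has $\beta=0$.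 * The *dilation subspace* $\mathfrak D(X)$ of $\mathcal D_A$ at $X$ is the linear span in $M_{n\times 1}(\mathbb R)^g$ of all $\beta$ for which there is a $\gamma\in\mathbb R^g$ with $\begin{pmatrix}X&\beta\\ \beta^*&\gamma\end{pmatrix}\in\mathcal D_A(n+1)$. * A tuple $\hat Y=\begin{pmatrix}X&\hat\beta\\ \hat\beta^*&\hat\gamma\end{pmatrix}\in\mathcal D_A(n+1)$ with $\hat\beta\in M_{n\times1}(\mathbb R)^g$ nonzero and $\hat\gamma\in\mathbb R^g$ is a *maximal $1$-dilation* of $X$ if (1) $1=\max\left\{\alpha\in\mathbb R:\ \exists\,\gamma\in\mathbb R^g,\ L_A\begin{pmatrix}X&\alpha\hat\beta\\ \alpha\hat\beta^*&\gamma\end{pmatrix}\succeq0\right\}$, and (2) $\hat\gamma$ is an extreme point of the convex set $\left\{\gamma\in\mathbb R^g:\ \begin{pmatrix}X&\hat\beta\\ \hat\beta^*&\gamma\end{pmatrix}\in\mathcal D_A(n+1)\right\}$. **Theorem.** Let $n\ge 1$ and let $X\in\mathcal D_A(n)$ not be an Arveson extreme point of $\mathcal D_A$. Then there exists a maximal $1$-dilation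 $\hat Y\in\mathcal D_A(n+1)$ of $X$. Furthermore, every maximal $1$-dilation $\hat Y\in\mathcal D_A(n+1)$ of $X$ satisfies $$\dim\mathfrak D(\hat Y)<\dim\mathfrak D(X).$$ -/

import Mathlib

open scoped TensorProduct

noncomputable section

namespace FreeSpec

/-- `M_{m × n}(ℝ)^g`: the `g`-tuples of real `m × n` matrices. -/
abbrev MatTuple (g m n : ℕ) : Type := Fin g → Matrix (Fin m) (Fin n) ℝ

/-- A set of `g`-tuples of square matrices of all sizes, given by its levels `K n`. -/
abbrev MatSet (g : ℕ) : Type := (n : ℕ) → Set (MatTuple g n n)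

/-- The tuple of block matrices with entries `X i`, `β i`, `(β i)ᵀ`, `γ i`, of size `n + l`. -/
def block {g n l : ℕ} (X : MatTuple g n n) (β : MatTuple g n l) (γ : MatTuple g l l) :
    MatTuple g (n + l) (n + l) :=
  fun i => Matrix.reindex finSumFinEquiv finSumFinEquiv
    (Matrix.fromBlocks (X i) (β i) (β i).transpose (γ i))

/-- A point of `ℝ^g` as a `g`-tuple of `1 × 1` matrices. -/
def scalarTuple {g : ℕ} (γ : Fin g → ℝ) : MatTuple g 1 1 :=
  fun i => Matrix.of fun _ _ => γ i

section Pencil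

variable {H : Type*} [NormedAddCommGroup H] [InnerProductSpace ℝ H]

/-- `Λ_A(X) = A₁ ⊗ X₁ + ⋯ + A_g ⊗ X_g`, an operator on the Hilbert space `H ⊗ ℝⁿ` (the algebraic
tensor product is already complete, since `ℝⁿ` is finite dimensional). -/
def linPart {g n : ℕ} (A : Fin g → H →L[ℝ] H) (X : MatTuple g n n) :
    (H ⊗[ℝ] EuclideanSpace ℝ (Fin n)) →ₗ[ℝ] (H ⊗[ℝ] EuclideanSpace ℝ (Fin n)) :=
  ∑ i, TensorProduct.map (A i : H →ₗ[ℝ] H) (Matrix.toEuclideanLin (X i))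

/-- The evaluation `L_A(X) = I - Λ_A(X)` of the monic linear pencil at `X`. -/
def pencil {g n : ℕ} (A : Fin g → H →L[ℝ] H) (X : MatTuple g n n) :
    (H ⊗[ℝ] EuclideanSpace ℝ (Fin n)) →ₗ[ℝ] (H ⊗[ℝ] EuclideanSpace ℝ (Fin n)) :=
  LinearMap.id - linPart A X

/-- The solution set `D_A` of the linear operator inequality `L_A(X) ⪰ 0` among tuples of real
symmetric matrices. -/
def spectrahedron {g : ℕ} (A : Fin g → H →L[ℝ] H) : MatSet g :=
  fun _ => {X | (∀ i, (X i).IsSymm) ∧ (pencil A X).IsPositive}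

end Pencil

/-- `K` is bounded: a single real `C` satisfies `C I - ∑ i, X_i² ⪰ 0` on all levels of `K`. -/
def IsBoundedSet {g : ℕ} (K : MatSet g) : Prop :=
  ∃ C : ℝ, ∀ n : ℕ, ∀ X ∈ K n,
    (C • (1 : Matrix (Fin n) (Fin n) ℝ) - ∑ i, X i ^ 2).PosSemidef

/-- `X` is an Arveson extreme point of `K`: all dilations of `X` in `K` are trivial. -/
def IsArvesonExtreme {g n : ℕ} (K : MatSet g) (X : MatTuple g n n) : Prop :=
  X ∈ K n ∧ ∀ (l : ℕ) (β : MatTuple g n l) (γ : MatTuple g l l),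
    (∀ i, (γ i).IsSymm) → block X β γ ∈ K (n + l) → β = 0

/-- The dilation subspace of `K` at `X`. -/
def dilationSubspace {g n : ℕ} (K : MatSet g) (X : MatTuple g n n) :
    Submodule ℝ (MatTuple g n 1) :=
  Submodule.span ℝ {β | ∃ γ : Fin g → ℝ, block X β (scalarTuple γ) ∈ K (n + 1)}

/-- The set of all `γ ∈ ℝ^g` that complete `X` and `β` to a `1`-dilation in `K`. -/
def gammaSet {g n : ℕ} (K : MatSet g) (X : MatTuple g n n) (β : MatTuple g n 1) :
    Set (Fin g → ℝ) :=
  {γ | block X β (scalarTuple γ) ∈ K (n + 1)}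

/-- `Y` is a maximal `1`-dilation of `X` in `D_A`. -/
def IsMaximalOneDilation {H : Type*} [NormedAddCommGroup H] [InnerProductSpace ℝ H] {g n : ℕ}
    (A : Fin g → H →L[ℝ] H) (X : MatTuple g n n) (Y : MatTuple g (n + 1) (n + 1)) : Prop :=
  Y ∈ spectrahedron A (n + 1) ∧
  ∃ (β : MatTuple g n 1) (γ : Fin g → ℝ),
    Y = block X β (scalarTuple γ) ∧
    β ≠ 0 ∧
    IsGreatest {α : ℝ | ∃ γ' : Fin g → ℝ,
      (pencil A (block X (α • β) (scalarTuple γ'))).IsPositive} 1 ∧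
    γ ∈ Set.extremePoints ℝ (gammaSet (spectrahedron A) X β)

end FreeSpec

end

/-! On `H ⊗ ℝⁿ ≃ Hⁿ`, positivity of the pencil says that the quadratic form `form A X` is
nonnegative. A column `β` lies in the dilation subspace of `X` exactly when its off-diagonal form
satisfies `|cross A β x v| ≤ M √(form A X x) ‖v‖` for some `M` (`IsDominated`), a condition linear
in `β`.

Let `Y` be a maximal 1-dilation with blocks `X, β, γ`. Forgetting the last row maps the dilation
subspace of `Y` into that of `X` (`dropLast_mem`). This map is injective: a kernel element is a last
row `σ`, and domination makes `∑ σ_i A_i`, placed in the last corner, vanish on the kernel of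
`L_A(Y)`. Compactness of the `A_i` gives `L_A(Y)` a spectral gap above `0`, so the corner is bounded
by a multiple of `L_A(Y)`; then `γ ± tσ` are both admissible for small `t > 0`, and extremality
forces `σ = 0` (`lastRow_eq_zero`). The image misses `β`, since a preimage would allow a dilation of
`X` along a larger multiple of `β` (`dropLast_ne`). Hence the dimension drops.

Existence is compactness: maximize the multiple of a nonzero `β`, then take an extreme point among
the admissible `γ`. -/

open scoped TensorProduct

noncomputable section

namespace FreeSpec

/-! ### The pencil as a quadratic form on `Hⁿ`. -/

section QuadraticForm

variable {H : Type*} [NormedAddCommGroup H] [InnerProductSpace ℝ H] {g : ℕ}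

/-- The bilinear form `(x, y) ↦ ∑ i a b, (β i) a b ⟪A i (y b), x a⟫`. -/
def cross {m n : ℕ} (A : Fin g → H →L[ℝ] H) (β : MatTuple g m n) (x : Fin m → H)
    (y : Fin n → H) : ℝ :=
  ∑ i, ∑ a, ∑ b, β i a b * inner ℝ (A i (y b)) (x a)

/-- The quadratic form of the pencil `L_A(X)` on `H ⊗ ℝⁿ ≃ Hⁿ`. -/
def form {n : ℕ} (A : Fin g → H →L[ℝ] H) (X : MatTuple g n n) (x : Fin n → H) : ℝ :=
  ∑ a, ‖x a‖ ^ 2 - cross A X x x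

/-- The quadratic form of `∑ i, γ i • A i`. -/
def lin (A : Fin g → H →L[ℝ] H) (γ : Fin g → ℝ) (v : H) : ℝ :=
  ∑ i, γ i * inner ℝ (A i v) v

/-- The tensor `∑ a, x a ⊗ e a` with coordinates `x`. -/
def tens {n : ℕ} (x : Fin n → H) : H ⊗[ℝ] EuclideanSpace ℝ (Fin n) :=
  ∑ a, x a ⊗ₜ EuclideanSpace.single a 1

lemma tens_surjective {n : ℕ} : Function.Surjective (tens (H := H) (n := n)) := by
  intro t
  induction t using TensorProduct.induction_on with
  | zero => exact ⟨0, by simp [tens]⟩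
  | tmul h e =>
    refine ⟨fun a => e a • h, ?_⟩
    have he : e = ∑ a, e a • EuclideanSpace.single a (1 : ℝ) := by
      ext b
      simp [Pi.single_apply]
    conv_rhs => rw [he]
    simp [tens, TensorProduct.tmul_sum, TensorProduct.smul_tmul]
  | add s t hs ht =>
    obtain ⟨x, rfl⟩ := hs
    obtain ⟨y, rfl⟩ := ht
    exact ⟨x + y, by simp [tens, TensorProduct.add_tmul, Finset.sum_add_distrib]⟩

lemma inner_tens {n : ℕ} (x y : Fin n → H) :
    inner ℝ (tens x) (tens y) = ∑ a, inner ℝ (x a) (y a) := by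
  simp [tens, sum_inner, inner_sum, TensorProduct.inner_tmul,
    EuclideanSpace.inner_single_left]

lemma linPart_tens {n : ℕ} (A : Fin g → H →L[ℝ] H) (X : MatTuple g n n) (x : Fin n → H) :
    linPart A X (tens x) = tens fun a => ∑ i, ∑ b, X i a b • A i (x b) := by
  have h : ∀ i b, Matrix.toEuclideanLin (X i) (EuclideanSpace.single b 1) =
      ∑ a, X i a b • EuclideanSpace.single a (1 : ℝ) := by
    intro i b
    ext c
    simp [Pi.single_apply, Matrix.toEuclideanLin]
  simp only [linPart, tens, LinearMap.sum_apply, map_sum, TensorProduct.map_tmul, h,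
    TensorProduct.tmul_sum, TensorProduct.sum_tmul, TensorProduct.smul_tmul,
    ContinuousLinearMap.coe_coe]
  rw [Finset.sum_comm]
  simp_rw [Finset.sum_comm (s := (Finset.univ : Finset (Fin g)))]
  exact Finset.sum_comm

lemma inner_pencil_tens {n : ℕ} (A : Fin g → H →L[ℝ] H) (X : MatTuple g n n)
    (x y : Fin n → H) :
    inner ℝ (pencil A X (tens x)) (tens y) = ∑ a, inner ℝ (x a) (y a) - cross A X y x := by
  simp only [pencil, LinearMap.sub_apply, LinearMap.id_apply, inner_sub_left, linPart_tens,
    inner_tens, cross, sum_inner, real_inner_smul_left]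
  rw [Finset.sum_comm]

lemma cross_comm {n : ℕ} {A : Fin g → H →L[ℝ] H} [CompleteSpace H]
    (hA : ∀ i, IsSelfAdjoint (A i)) {X : MatTuple g n n} (hX : ∀ i, (X i).IsSymm)
    (x y : Fin n → H) : cross A X x y = cross A X y x := by
  unfold cross
  refine Finset.sum_congr rfl fun i _ => ?_
  rw [Finset.sum_comm]
  refine Finset.sum_congr rfl fun a _ => Finset.sum_congr rfl fun b _ => ?_
  rw [(hX i).apply, real_inner_comm, ← (hA i).isSymmetric.apply_clm]

variable [CompleteSpace H]

lemma pencil_isPositive_iff {n : ℕ} {A : Fin g → H →L[ℝ] H}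
    (hA : ∀ i, IsSelfAdjoint (A i)) {X : MatTuple g n n} (hX : ∀ i, (X i).IsSymm) :
    (pencil A X).IsPositive ↔ ∀ x, 0 ≤ form A X x := by
  have key : ∀ x, inner ℝ (pencil A X (tens x)) (tens x) = form A X x := fun x => by
    simp [inner_pencil_tens, form]
  constructor
  · intro h x
    have := h.2 (tens x)
    rwa [RCLike.re_to_real, key] at this
  · refine fun h => ⟨fun s t => ?_, fun s => ?_⟩
    · obtain ⟨x, rfl⟩ := tens_surjective s
      obtain ⟨y, rfl⟩ := tens_surjective t
      rw [inner_pencil_tens, real_inner_comm, inner_pencil_tens, cross_comm hA hX]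
      simp only [real_inner_comm]
    · obtain ⟨x, rfl⟩ := tens_surjective s
      rw [RCLike.re_to_real, key]
      exact h x

end QuadraticForm

/-! ### The spectral gap supplied by compactness. -/

section Kernel

section Gap

variable {E : Type*} [NormedAddCommGroup E] [InnerProductSpace ℝ E]

/-- Cauchy–Schwarz for the positive semidefinite form of `L`. -/
lemma norm_sq_le_of_nonneg {L : E →L[ℝ] E} (hs : ∀ x y, inner ℝ (L x) y = inner ℝ x (L y))
    (hp : ∀ x, 0 ≤ inner ℝ (L x) x) (u : E) : ‖L u‖ ^ 2 ≤ ‖L‖ * inner ℝ (L u) u := by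
  -- Positivity at `u - s • L u`; the discriminant in `s` then gives `‖L u‖⁴ ≤ ⟪L (L u), L u⟫ ⟪L u,
  -- u⟫`.
  have hq : ∀ s : ℝ, 0 ≤ inner ℝ (L (L u)) (L u) * (s * s) + (-2 * ‖L u‖ ^ 2) * s
      + inner ℝ (L u) u := by
    intro s
    have := hp (u - s • L u)
    simp only [map_sub, map_smul, inner_sub_left, inner_sub_right, real_inner_smul_left,
      real_inner_smul_right] at this
    rw [hs (L u) u, real_inner_self_eq_norm_sq] at this
    linarith
  have hd := discrim_le_zero hq
  rw [discrim] at hd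
  have h1 : inner ℝ (L (L u)) (L u) ≤ ‖L‖ * ‖L u‖ ^ 2 :=
    calc _ ≤ ‖L (L u)‖ * ‖L u‖ := real_inner_le_norm _ _
      _ ≤ (‖L‖ * ‖L u‖) * ‖L u‖ := by gcongr; exact L.le_opNorm _
      _ = _ := by ring
  have h2 := mul_le_mul_of_nonneg_right h1 (hp u)
  rcases eq_or_ne (L u) 0 with h | h
  · simp [h]
  · have h3 : 0 < ‖L u‖ ^ 2 := by positivity
    refine le_of_mul_le_mul_left ?_ h3
    nlinarith

/-- If `1 - T` is positive with `T` compact, then every self-adjoint `S` that vanishes on the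
kernel of `1 - T` is dominated by a multiple of `1 - T`. -/
lemma exists_abs_inner_le_of_compact [CompleteSpace E] {T S : E →L[ℝ] E}
    (hT : ∀ x y, inner ℝ (T x) y = inner ℝ x (T y)) (hTc : IsCompactOperator T)
    (hp : ∀ x, 0 ≤ inner ℝ (x - T x) x) (hS : ∀ x y, inner ℝ (S x) y = inner ℝ x (S y))
    (hker : ∀ x, T x = x → S x = 0) :
    ∃ C : ℝ, 0 ≤ C ∧ ∀ x, |inner ℝ (S x) x| ≤ C * inner ℝ (x - T x) x := by
  set L : E →L[ℝ] E := ContinuousLinearMap.id ℝ E - T with hL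
  have hLx : ∀ x, L x = x - T x := fun x => rfl
  have hLs : ∀ x y, inner ℝ (L x) y = inner ℝ x (L y) := fun x y => by
    simp only [hLx, inner_sub_left, inner_sub_right, hT]
  set V : Submodule ℝ E := LinearMap.ker (L : E →ₗ[ℝ] E) with hV
  have hVmem : ∀ x, x ∈ V ↔ L x = 0 := fun x => by simp [hV]
  have hVc : IsClosed (V : Set E) := L.isClosed_ker
  have : CompleteSpace V := hVc.completeSpace_coe
  have hinv : ∀ v ∈ Vᗮ, (T : E →ₗ[ℝ] E) v ∈ Vᗮ := by
    intro v hv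
    rw [Submodule.mem_orthogonal] at hv ⊢
    intro k hk
    have : T k = k := by
      have := (hVmem k).1 hk
      rw [hLx, sub_eq_zero] at this
      exact this.symm
    simp only [ContinuousLinearMap.coe_coe]
    rw [← hT, this]
    exact hv k hk
  have hcomp : IsCompactOperator ((T : E →ₗ[ℝ] E).restrict hinv) :=
    IsCompactOperator.restrict' (f := (T : E →ₗ[ℝ] E)) hTc hinv
  set T' : Vᗮ →L[ℝ] Vᗮ := ContinuousLinearMap.mkOfIsCompactOperator hcomp with hT'
  have hT'x : ∀ v : Vᗮ, ((T' v : Vᗮ) : E) = T v := fun v => rfl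
  have hne : ¬ Module.End.HasEigenvalue (T' : Module.End ℝ Vᗮ) 1 := by
    intro h
    obtain ⟨v, hv⟩ := h.exists_hasEigenvector
    have h1 : T v = v := by
      have := congrArg (Subtype.val) hv.apply_eq_smul
      simpa [hT'x] using this
    have h2 : (v : E) ∈ V := by rw [hVmem, hLx, h1, sub_self]
    have h3 := (Submodule.mem_orthogonal _ _).1 v.2 v h2
    exact hv.2 (Subtype.ext (inner_self_eq_zero.1 h3))
  -- Fredholm alternative: `1` is nonzero and not an eigenvalue of the compact `T'`, so `T' - 1` is
  -- bounded below.
  obtain ⟨K, hK⟩ := IsCompactOperator.antilipschitz_of_not_hasEigenvalue (T := T') hcomp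
    one_ne_zero hne
  have hK' : ∀ v ∈ Vᗮ, ‖v‖ ≤ K * ‖L v‖ := by
    intro v hv
    have := hK.le_mul_norm (map_zero _) ⟨v, hv⟩
    have h4 : ‖(T' - (1 : ℝ) • 1 : Vᗮ →L[ℝ] Vᗮ) ⟨v, hv⟩‖ = ‖L v‖ := by
      have h5 : L v = -(((T' - (1 : ℝ) • 1 : Vᗮ →L[ℝ] Vᗮ) ⟨v, hv⟩ : Vᗮ) : E) := by
        simp [hT'x, hLx]
      rw [h5, norm_neg, Submodule.coe_norm]
    rw [h4] at this
    simpa using this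
  refine ⟨‖S‖ * K ^ 2 * ‖L‖, by positivity, fun x => ?_⟩
  -- Both forms ignore the component `k` in the kernel, so only `v ∈ Vᗮ` has to be estimated.
  obtain ⟨k, hk, v, hv, rfl⟩ := V.exists_add_mem_mem_orthogonal x
  have hLk := (hVmem k).1 hk
  have hSk : S k = 0 := hker k (by rw [hLx, sub_eq_zero] at hLk; exact hLk.symm)
  have e1 : inner ℝ (S (k + v)) (k + v) = inner ℝ (S v) v := by
    rw [map_add, hSk, zero_add, inner_add_right, hS v k, hSk, inner_zero_right, zero_add]
  have e2 : inner ℝ (L (k + v)) (k + v) = inner ℝ (L v) v := by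
    rw [map_add, hLk, zero_add, inner_add_right, hLs v k, hLk, inner_zero_right, zero_add]
  rw [← hLx, e1, e2]
  calc |inner ℝ (S v) v| ≤ ‖S v‖ * ‖v‖ := abs_real_inner_le_norm _ _
    _ ≤ (‖S‖ * ‖v‖) * ‖v‖ := by gcongr; exact S.le_opNorm _
    _ = ‖S‖ * ‖v‖ ^ 2 := by ring
    _ ≤ ‖S‖ * (K * ‖L v‖) ^ 2 := by gcongr; exact hK' v hv
    _ = ‖S‖ * K ^ 2 * ‖L v‖ ^ 2 := by ring
    _ ≤ ‖S‖ * K ^ 2 * (‖L‖ * inner ℝ (L v) v) := by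
        gcongr
        exact norm_sq_le_of_nonneg hLs hp v
    _ = _ := by ring

end Gap

variable {H : Type*} [NormedAddCommGroup H] [InnerProductSpace ℝ H] {g : ℕ}

/-- The operator on `Hⁿ` with quadratic form `cross A X`. -/
def opOf {n : ℕ} (A : Fin g → H →L[ℝ] H) (X : MatTuple g n n) :
    PiLp 2 (fun _ : Fin n => H) →L[ℝ] PiLp 2 (fun _ : Fin n => H) :=
  (PiLp.continuousLinearEquiv 2 ℝ (fun _ : Fin n => H)).symm.toContinuousLinearMap ∘L
    ∑ i, ∑ a, ∑ b, X i a b • (ContinuousLinearMap.single ℝ (fun _ : Fin n => H) a ∘L A i ∘L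
      PiLp.proj 2 (fun _ : Fin n => H) b)

lemma inner_opOf {n : ℕ} (A : Fin g → H →L[ℝ] H) (X : MatTuple g n n)
    (u w : PiLp 2 (fun _ : Fin n => H)) : inner ℝ (opOf A X u) w = cross A X w u := by
  simp only [opOf, cross, PiLp.inner_apply, ContinuousLinearMap.comp_apply]
  simp only [ContinuousLinearEquiv.coe_coe, PiLp.coe_symm_continuousLinearEquiv,
    sum_apply, Finset.sum_apply, smul_apply,
    Pi.smul_apply, ContinuousLinearMap.comp_apply, ContinuousLinearMap.single_apply, sum_inner,
    real_inner_smul_left, PiLp.proj_apply, Pi.single_apply]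
  rw [Finset.sum_comm]
  refine Finset.sum_congr rfl fun i _ => ?_
  rw [Finset.sum_comm]
  refine Finset.sum_congr rfl fun a _ => ?_
  rw [Finset.sum_comm]
  refine Finset.sum_congr rfl fun b _ => ?_
  rw [Finset.sum_eq_single a]
  · simp
  · intro c _ hc
    simp [hc]
  · simp

lemma isCompactOperator_sum {ι E F : Type*} [NormedAddCommGroup E] [NormedSpace ℝ E]
    [NormedAddCommGroup F] [NormedSpace ℝ F] (s : Finset ι) (f : ι → E →L[ℝ] F)
    (h : ∀ i ∈ s, IsCompactOperator (f i)) : IsCompactOperator (∑ i ∈ s, f i : E →L[ℝ] F) :=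
  (compactOperator (RingHom.id ℝ) E F).sum_mem h

lemma isCompactOperator_opOf {n : ℕ} {A : Fin g → H →L[ℝ] H}
    (hAc : ∀ i, IsCompactOperator (A i)) (X : MatTuple g n n) : IsCompactOperator (opOf A X) := by
  have h : ∀ i a b, IsCompactOperator
      (X i a b • (ContinuousLinearMap.single ℝ (fun _ : Fin n => H) a ∘L A i ∘L
        PiLp.proj 2 (fun _ : Fin n => H) b)) := fun i a b =>
    ((IsCompactOperator.comp_clm (hAc i) (PiLp.proj (𝕜 := ℝ) 2 (fun _ : Fin n => H) b)).clm_comp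
      (ContinuousLinearMap.single ℝ (fun _ : Fin n => H) a)).smul (X i a b)
  exact (isCompactOperator_sum _ _ fun i _ => isCompactOperator_sum _ _ fun a _ =>
    isCompactOperator_sum _ _ fun b _ => h i a b).clm_comp
      (PiLp.continuousLinearEquiv 2 ℝ (fun _ : Fin n => H)).symm.toContinuousLinearMap

variable [CompleteSpace H]

lemma exists_abs_cross_le {n : ℕ} {A : Fin g → H →L[ℝ] H} (hA : ∀ i, IsSelfAdjoint (A i))
    (hAc : ∀ i, IsCompactOperator (A i)) {X Z : MatTuple g n n} (hX : ∀ i, (X i).IsSymm)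
    (hZ : ∀ i, (Z i).IsSymm) (hp : ∀ x, 0 ≤ form A X x)
    (hker : ∀ x, form A X x = 0 → ∀ y, cross A Z y x = 0) :
    ∃ C : ℝ, 0 ≤ C ∧ ∀ x, |cross A Z x x| ≤ C * form A X x := by
  have hs : ∀ {W : MatTuple g n n}, (∀ i, (W i).IsSymm) → ∀ u w,
      inner ℝ (opOf A W u) w = inner ℝ u (opOf A W w) := fun hW u w => by
    rw [real_inner_comm (opOf A _ w) u, inner_opOf, inner_opOf, cross_comm hA hW]
  have hf : ∀ u : PiLp 2 (fun _ : Fin n => H),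
      inner ℝ (u - opOf A X u) u = form A X u := fun u => by
    rw [inner_sub_left, inner_opOf, real_inner_self_eq_norm_sq, PiLp.norm_sq_eq_of_L2, form]
  obtain ⟨C, hC, h⟩ := exists_abs_inner_le_of_compact (hs hX) (isCompactOperator_opOf hAc X)
    (fun u => by rw [hf]; exact hp u) (hs hZ) (fun u hu => by
      rw [← inner_self_eq_zero (𝕜 := ℝ), inner_opOf]
      refine hker u ?_ _
      rw [← hf, hu, sub_self, inner_zero_left])
  refine ⟨C, hC, fun x => ?_⟩
  have := h (WithLp.toLp 2 x)
  rwa [hf, inner_opOf] at this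

end Kernel

/-! ### Block forms, and the dilation subspace as the dominated columns. -/

section Domination

variable {H : Type*} [NormedAddCommGroup H] [InnerProductSpace ℝ H] {g : ℕ}

section Cross

variable {m n : ℕ} (A : Fin g → H →L[ℝ] H)

lemma cross_smul (c : ℝ) (β : MatTuple g m n) (x : Fin m → H) (y : Fin n → H) :
    cross A (c • β) x y = c * cross A β x y := by
  simp [cross, Finset.mul_sum, mul_assoc]

lemma cross_add (β β' : MatTuple g m n) (x : Fin m → H) (y : Fin n → H) :
    cross A (β + β') x y = cross A β x y + cross A β' x y := by
  simp [cross, add_mul, Finset.sum_add_distrib]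

lemma cross_zero (x : Fin m → H) (y : Fin n → H) :
    cross A (0 : MatTuple g m n) x y = 0 := by
  simp [cross]

lemma cross_smul_left (c : ℝ) (β : MatTuple g m n) (x : Fin m → H) (y : Fin n → H) :
    cross A β (c • x) y = c * cross A β x y := by
  simp [cross, Finset.mul_sum, real_inner_smul_right, mul_left_comm]

lemma cross_const_smul (c : ℝ) (β : MatTuple g m 1) (x : Fin m → H) (v : H) :
    cross A β x (fun _ => c • v) = c * cross A β x (fun _ => v) := by
  simp [cross, Finset.mul_sum, real_inner_smul_left, mul_left_comm]

lemma form_smul (c : ℝ) (X : MatTuple g n n) (x : Fin n → H) :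
    form A X (c • x) = c ^ 2 * form A X x := by
  simp only [form, cross, Pi.smul_apply, norm_smul, mul_pow, Real.norm_eq_abs, sq_abs, map_smul,
    real_inner_smul_left, real_inner_smul_right, mul_sub, Finset.mul_sum]
  congr 1
  refine Finset.sum_congr rfl fun i _ => Finset.sum_congr rfl fun a _ =>
    Finset.sum_congr rfl fun b _ => ?_
  ring

lemma lin_smul (c : ℝ) (γ : Fin g → ℝ) (v : H) : lin A γ (c • v) = c ^ 2 * lin A γ v := by
  simp only [lin, map_smul, real_inner_smul_left, real_inner_smul_right, Finset.mul_sum]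
  exact Finset.sum_congr rfl fun i _ => by ring

lemma lin_add (γ δ : Fin g → ℝ) (v : H) : lin A (γ + δ) v = lin A γ v + lin A δ v := by
  simp [lin, add_mul, Finset.sum_add_distrib]

lemma smul_lin (c : ℝ) (γ : Fin g → ℝ) (v : H) : lin A (c • γ) v = c * lin A γ v := by
  simp [lin, Finset.mul_sum, mul_assoc]

lemma lin_zero (v : H) : lin A 0 v = 0 := by simp [lin]

lemma form_scalarTuple (γ : Fin g → ℝ) (v : H) :
    form A (scalarTuple γ) (fun _ => v) = ‖v‖ ^ 2 - lin A γ v := by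
  simp [form, cross, scalarTuple, lin]

lemma scalarTuple_isSymm (γ : Fin g → ℝ) (i : Fin g) : (scalarTuple γ i).IsSymm := by
  ext a b
  simp [scalarTuple]

lemma lin_le (A : Fin g → H →L[ℝ] H) (γ : Fin g → ℝ) (v : H) :
    -lin A γ v ≤ (∑ i, |γ i| * ‖A i‖) * ‖v‖ ^ 2 := by
  rw [lin, ← Finset.sum_neg_distrib, Finset.sum_mul]
  refine Finset.sum_le_sum fun i _ => ?_
  calc -(γ i * inner ℝ (A i v) v) ≤ |γ i * inner ℝ (A i v) v| := neg_le_abs _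
    _ = |γ i| * |inner ℝ (A i v) v| := abs_mul _ _
    _ ≤ |γ i| * ((‖A i‖ * ‖v‖) * ‖v‖) := by
        gcongr
        exact (abs_real_inner_le_norm _ _).trans (by gcongr; exact (A i).le_opNorm v)
    _ = _ := by ring

end Cross

section Block

variable {n l : ℕ} (X : MatTuple g n n) (β : MatTuple g n l) (γ : MatTuple g l l) (i : Fin g)

@[simp] lemma block_castAdd_castAdd (a b : Fin n) :
    block X β γ i (Fin.castAdd l a) (Fin.castAdd l b) = X i a b := by simp [block]

@[simp] lemma block_castAdd_natAdd (a : Fin n) (b : Fin l) :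
    block X β γ i (Fin.castAdd l a) (Fin.natAdd n b) = β i a b := by simp [block]

@[simp] lemma block_natAdd_castAdd (a : Fin l) (b : Fin n) :
    block X β γ i (Fin.natAdd n a) (Fin.castAdd l b) = β i b a := by simp [block]

@[simp] lemma block_natAdd_natAdd (a b : Fin l) :
    block X β γ i (Fin.natAdd n a) (Fin.natAdd n b) = γ i a b := by simp [block]

variable {X γ}

lemma block_isSymm (hX : ∀ i, (X i).IsSymm) (hγ : ∀ i, (γ i).IsSymm) :
    (block X β γ i).IsSymm := by
  exact (Matrix.isSymm_fromBlocks_iff.2 ⟨hX i, rfl, by simp, hγ i⟩).submatrix _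

end Block

lemma cross_append {m k n : ℕ} (A : Fin g → H →L[ℝ] H) (b : MatTuple g (m + k) n)
    (x : Fin m → H) (y : Fin k → H) (v : Fin n → H) :
    cross A b (Fin.append x y) v =
      cross A (fun i => (b i).submatrix (Fin.castAdd k) id) x v +
      cross A (fun i => (b i).submatrix (Fin.natAdd m) id) y v := by
  simp [cross, Fin.sum_univ_add, Finset.sum_add_distrib]

lemma exists_eq_append_const {E : Type*} {n : ℕ} (w : Fin (n + 1) → E) :
    ∃ (x : Fin n → E) (v : E), w = Fin.append x fun _ => v :=
  ⟨fun a => w (Fin.castAdd 1 a), w (Fin.natAdd n 0), by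
    conv_lhs => rw [← Fin.append_castAdd_natAdd (f := w)]
    congr 1
    ext a
    rw [Subsingleton.elim a 0]⟩

variable [CompleteSpace H] {A : Fin g → H →L[ℝ] H} {n : ℕ}

lemma cross_block {l : ℕ} (hA : ∀ i, IsSelfAdjoint (A i)) (X : MatTuple g n n)
    (β : MatTuple g n l) (γ : MatTuple g l l) (x y : Fin n → H) (v w : Fin l → H) :
    cross A (block X β γ) (Fin.append x v) (Fin.append y w) =
      cross A X x y + cross A β x w + cross A β y v + cross A γ v w := by
  have h : cross A β y v = ∑ i, ∑ a, ∑ b, β i b a * inner ℝ (A i (y b)) (v a) := by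
    unfold cross
    refine Finset.sum_congr rfl fun i _ => ?_
    rw [Finset.sum_comm]
    refine Finset.sum_congr rfl fun a _ => Finset.sum_congr rfl fun b _ => ?_
    rw [real_inner_comm, ← (hA i).isSymmetric.apply_clm]
  rw [h]
  simp only [cross, Fin.sum_univ_add, Fin.append_left, Fin.append_right, block_castAdd_castAdd,
    block_castAdd_natAdd, block_natAdd_castAdd, block_natAdd_natAdd, Finset.sum_add_distrib]
  ring

lemma form_block {l : ℕ} (hA : ∀ i, IsSelfAdjoint (A i)) (X : MatTuple g n n)
    (β : MatTuple g n l) (γ : MatTuple g l l) (x : Fin n → H) (v : Fin l → H) :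
    form A (block X β γ) (Fin.append x v) = form A X x + form A γ v - 2 * cross A β x v := by
  simp only [form, cross_block hA, Fin.sum_univ_add, Fin.append_left, Fin.append_right]
  ring

lemma form_block_scalarTuple (hA : ∀ i, IsSelfAdjoint (A i)) (X : MatTuple g n n)
    (β : MatTuple g n 1) (γ : Fin g → ℝ) (x : Fin n → H) (v : H) :
    form A (block X β (scalarTuple γ)) (Fin.append x fun _ => v) =
      form A X x + (‖v‖ ^ 2 - lin A γ v) - 2 * cross A β x (fun _ => v) := by
  rw [form_block hA, form_scalarTuple]

lemma pencil_block_isPositive_iff (hA : ∀ i, IsSelfAdjoint (A i)) {X : MatTuple g n n}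
    (hX : ∀ i, (X i).IsSymm) (β : MatTuple g n 1) (γ : Fin g → ℝ) :
    (pencil A (block X β (scalarTuple γ))).IsPositive ↔ ∀ x v,
      0 ≤ form A X x + (‖v‖ ^ 2 - lin A γ v) - 2 * cross A β x (fun _ => v) := by
  rw [pencil_isPositive_iff hA fun i => block_isSymm β i hX (scalarTuple_isSymm γ)]
  constructor
  · intro h x v
    rw [← form_block_scalarTuple hA]
    exact h _
  · intro h w
    obtain ⟨x, v, rfl⟩ := exists_eq_append_const w
    rw [form_block_scalarTuple hA]
    exact h x v

lemma block_mem_iff (hA : ∀ i, IsSelfAdjoint (A i)) {X : MatTuple g n n}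
    (hX : ∀ i, (X i).IsSymm) (β : MatTuple g n 1) (γ : Fin g → ℝ) :
    block X β (scalarTuple γ) ∈ spectrahedron A (n + 1) ↔ ∀ x v,
      0 ≤ form A X x + (‖v‖ ^ 2 - lin A γ v) - 2 * cross A β x (fun _ => v) := by
  rw [← pencil_block_isPositive_iff hA hX]
  exact and_iff_right fun i => block_isSymm β i hX (scalarTuple_isSymm γ)

/-- The off-diagonal block of `L_A` given by `β` is dominated by `L_A(X)`. -/
def IsDominated (A : Fin g → H →L[ℝ] H) (X : MatTuple g n n) (β : MatTuple g n 1) : Prop :=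
  ∃ M : ℝ, 0 ≤ M ∧ ∀ x v, |cross A β x (fun _ => v)| ≤ M * √(form A X x) * ‖v‖

lemma isDominated_of_block_mem (hA : ∀ i, IsSelfAdjoint (A i)) {X : MatTuple g n n}
    (hX : X ∈ spectrahedron A n) {β : MatTuple g n 1} {γ : Fin g → ℝ}
    (h : block X β (scalarTuple γ) ∈ spectrahedron A (n + 1)) : IsDominated A X β := by
  rw [block_mem_iff hA hX.1] at h
  have hQ := (pencil_isPositive_iff hA hX.1).1 hX.2
  set C := 1 + ∑ i, |γ i| * ‖A i‖ with hC
  have hC0 : 0 ≤ C := by positivity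
  refine ⟨√C, by positivity, fun x v => abs_le_of_sq_le_sq ?_ (by positivity)⟩
  rw [mul_pow, mul_pow, Real.sq_sqrt hC0, Real.sq_sqrt (hQ x)]
  -- Scaling `x` by `s` alone gives a quadratic in `s`; its discriminant bounds `(cross A β x v)²`
  -- by `form A X x * (‖v‖² - lin A γ v)`.
  have hq : ∀ s : ℝ, 0 ≤ form A X x * (s * s) + (-2 * cross A β x fun _ => v) * s
      + (‖v‖ ^ 2 - lin A γ v) := by
    intro s
    have := h (s • x) v
    rw [form_smul, cross_smul_left] at this
    linarith
  have hd := discrim_le_zero hq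
  rw [discrim] at hd
  have h1 : ‖v‖ ^ 2 - lin A γ v ≤ C * ‖v‖ ^ 2 := by
    have := lin_le A γ v
    rw [hC]
    linarith
  have h2 := mul_le_mul_of_nonneg_left h1 (hQ x)
  linarith

lemma isDominated_of_mem (hA : ∀ i, IsSelfAdjoint (A i)) {X : MatTuple g n n}
    (hX : X ∈ spectrahedron A n) {β : MatTuple g n 1}
    (h : β ∈ dilationSubspace (spectrahedron A) X) : IsDominated A X β := by
  induction h using Submodule.span_induction with
  | mem β h =>
    obtain ⟨γ, h⟩ := h
    exact isDominated_of_block_mem hA hX h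
  | zero => exact ⟨0, le_rfl, fun x v => by simp [cross_zero]⟩
  | add β β' _ _ h h' =>
    obtain ⟨M, hM, h⟩ := h
    obtain ⟨M', hM', h'⟩ := h'
    refine ⟨M + M', by positivity, fun x v => ?_⟩
    rw [cross_add, add_mul, add_mul]
    exact (abs_add_le _ _).trans (add_le_add (h x v) (h' x v))
  | smul c β _ h =>
    obtain ⟨M, hM, h⟩ := h
    refine ⟨|c| * M, by positivity, fun x v => ?_⟩
    rw [cross_smul, abs_mul, mul_assoc, mul_assoc, ← mul_assoc M]
    exact mul_le_mul_of_nonneg_left (h x v) (abs_nonneg c)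

/-- Once `β` is scaled so that the domination constant is at most `1`, AM-GM absorbs the cross term
into `form A X x + ‖v‖²`, so `γ = 0` suffices. Using `M + 1` covers `M = 0`. -/
lemma IsDominated.exists_block_mem (hA : ∀ i, IsSelfAdjoint (A i)) {X : MatTuple g n n}
    (hX : X ∈ spectrahedron A n) {β : MatTuple g n 1} (h : IsDominated A X β) :
    ∃ c : ℝ, 0 < c ∧ block X (c • β) (scalarTuple 0) ∈ spectrahedron A (n + 1) := by
  obtain ⟨M, hM, h⟩ := h
  have hQ := (pencil_isPositive_iff hA hX.1).1 hX.2
  refine ⟨(M + 1)⁻¹, by positivity, (block_mem_iff hA hX.1 _ _).2 fun x v => ?_⟩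
  rw [cross_smul, lin_zero]
  have h1 : (M + 1)⁻¹ * cross A β x (fun _ => v) ≤ √(form A X x) * ‖v‖ := by
    rw [inv_mul_le_iff₀ (by positivity)]
    have := (le_abs_self _).trans (h x v)
    have : 0 ≤ √(form A X x) * ‖v‖ := by positivity
    linarith
  have h2 := two_mul_le_add_sq (√(form A X x)) ‖v‖
  rw [Real.sq_sqrt (hQ x)] at h2
  linarith

lemma IsDominated.mem (hA : ∀ i, IsSelfAdjoint (A i)) {X : MatTuple g n n}
    (hX : X ∈ spectrahedron A n) {β : MatTuple g n 1} (h : IsDominated A X β) :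
    β ∈ dilationSubspace (spectrahedron A) X := by
  obtain ⟨c, hc, h⟩ := h.exists_block_mem hA hX
  have := Submodule.smul_mem (dilationSubspace (spectrahedron A) X) c⁻¹
    (Submodule.subset_span ⟨0, h⟩)
  rwa [inv_smul_smul₀ hc.ne'] at this

end Domination

/-! ### The dimension drop at a maximal 1-dilation. -/

section MaximalDilation

variable {H : Type*} [NormedAddCommGroup H] [InnerProductSpace ℝ H] {g n : ℕ}

/-- Forgetting the last row of a tuple of columns. -/
def dropLast : MatTuple g (n + 1) 1 →ₗ[ℝ] MatTuple g n 1 where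
  toFun b i := (b i).submatrix (Fin.castAdd 1) id
  map_add' _ _ := rfl
  map_smul' _ _ := rfl

/-- The last row of a tuple of columns. -/
def lastRow (b : MatTuple g (n + 1) 1) : Fin g → ℝ := fun i => b i (Fin.natAdd n 0) 0

lemma cross_append_const (A : Fin g → H →L[ℝ] H) (b : MatTuple g (n + 1) 1)
    (x : Fin n → H) (y v : H) :
    cross A b (Fin.append x fun _ => y) (fun _ => v) =
      cross A (dropLast b) x (fun _ => v) + ∑ i, lastRow b i * inner ℝ (A i v) y := by
  rw [cross_append]
  congr 1
  simp [cross, lastRow]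

lemma eq_zero_of_dropLast_eq_zero {b : MatTuple g (n + 1) 1} (h : dropLast b = 0)
    (h' : lastRow b = 0) : b = 0 := by
  ext i a c
  rw [Subsingleton.elim c 0]
  induction a using Fin.addCases with
  | left a => exact congrFun (congrFun (congrFun h i) a) 0
  | right a =>
    rw [Subsingleton.elim a 0]
    exact congrFun h' i

/-- The diagonal entry at `a` of the positive semidefinite matrix is `C` minus the sum of the
squares of row `a` over all `X i`. -/
lemma sq_apply_le_of_posSemidef {C : ℝ} {X : MatTuple g n n} (hX : ∀ i, (X i).IsSymm)
    (h : (C • (1 : Matrix (Fin n) (Fin n) ℝ) - ∑ i, X i ^ 2).PosSemidef) (i : Fin g)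
    (a b : Fin n) : X i a b ^ 2 ≤ C := by
  have h1 := h.diag_nonneg (i := a)
  have h2 : ∀ i, (X i ^ 2) a a = ∑ b, X i a b ^ 2 := fun i => by
    rw [sq, Matrix.mul_apply]
    exact Finset.sum_congr rfl fun b _ => by rw [(hX i).apply a b, sq]
  simp only [Matrix.sub_apply, Matrix.smul_apply, Matrix.one_apply_eq, smul_eq_mul, mul_one,
    Matrix.sum_apply, h2, sub_nonneg] at h1
  calc X i a b ^ 2 ≤ ∑ b, X i a b ^ 2 :=
        Finset.single_le_sum (f := fun b => X i a b ^ 2) (fun _ _ => sq_nonneg _)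
          (Finset.mem_univ b)
    _ ≤ ∑ i, ∑ b, X i a b ^ 2 :=
        Finset.single_le_sum (f := fun i => ∑ b, X i a b ^ 2)
          (fun _ _ => Finset.sum_nonneg fun _ _ => sq_nonneg _) (Finset.mem_univ i)
    _ ≤ C := h1

variable [CompleteSpace H] {A : Fin g → H →L[ℝ] H}

section Maximal

variable {X : MatTuple g n n} {β : MatTuple g n 1} {γ : Fin g → ℝ}

lemma dropLast_mem (hA : ∀ i, IsSelfAdjoint (A i)) (hX : X ∈ spectrahedron A n)
    (hY : block X β (scalarTuple γ) ∈ spectrahedron A (n + 1)) {b : MatTuple g (n + 1) 1}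
    (hb : b ∈ dilationSubspace (spectrahedron A) (block X β (scalarTuple γ))) :
    dropLast b ∈ dilationSubspace (spectrahedron A) X := by
  obtain ⟨M, hM, h⟩ := isDominated_of_mem hA hY hb
  -- Domination over the block tuple is tested on vectors whose last coordinate is `0`, where its
  -- form reduces to that of `X`.
  refine IsDominated.mem hA hX ⟨M, hM, fun x v => ?_⟩
  have := h (Fin.append x fun _ => 0) v
  rw [cross_append_const, form_block_scalarTuple hA] at this
  have h0 : cross A β x (fun _ => (0 : H)) = 0 := by simp [cross]
  simpa [lin, h0] using this

/-- A dilation direction at `(X, β, γ)` supported on its last row vanishes, since otherwise `γ` could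
be moved both ways along it, contrary to extremality. -/
lemma lastRow_eq_zero (hA : ∀ i, IsSelfAdjoint (A i)) (hAc : ∀ i, IsCompactOperator (A i))
    (hX : X ∈ spectrahedron A n)
    (hγ : γ ∈ Set.extremePoints ℝ (gammaSet (spectrahedron A) X β)) {b : MatTuple g (n + 1) 1}
    (hb : b ∈ dilationSubspace (spectrahedron A) (block X β (scalarTuple γ)))
    (h0 : dropLast b = 0) : lastRow b = 0 := by
  have hY : block X β (scalarTuple γ) ∈ spectrahedron A (n + 1) := hγ.1
  obtain ⟨M, hM, h⟩ := isDominated_of_mem hA hY hb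
  have hp := (pencil_isPositive_iff hA hY.1).1 hY.2
  set σ := lastRow b with hσ
  set Z : MatTuple g (n + 1) (n + 1) := block 0 0 (scalarTuple σ) with hZ
  have hZs : ∀ i, (Z i).IsSymm :=
    fun i => block_isSymm 0 i (fun _ => Matrix.isSymm_zero) (scalarTuple_isSymm σ)
  have hZc : ∀ (x y : Fin n → H) (v w : H), cross A Z (Fin.append x fun _ => v)
      (Fin.append y fun _ => w) = ∑ i, σ i * inner ℝ (A i w) v := fun x y v w => by
    rw [hZ, cross_block hA, cross_zero, cross_zero, cross_zero]
    simp [cross, scalarTuple]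
  -- Where the form of the dilation vanishes, the domination bound is zero, so `Z` vanishes there
  -- too and the gap estimate applies.
  obtain ⟨C, hC, hdom⟩ := exists_abs_cross_le hA hAc hY.1 hZs hp fun x hx y => by
    obtain ⟨x, v, rfl⟩ := exists_eq_append_const x
    obtain ⟨y, w, rfl⟩ := exists_eq_append_const y
    have := h (Fin.append x fun _ => v) w
    rw [hx, cross_append_const, h0, cross_zero, Real.sqrt_zero, mul_zero, zero_mul, zero_add,
      abs_nonpos_iff] at this
    rw [cross_comm hA hZs, hZc, this]
  have hmem : ∀ t : ℝ, |t| * C ≤ 1 → γ + t • σ ∈ gammaSet (spectrahedron A) X β := by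
    intro t ht
    refine (block_mem_iff hA hX.1 _ _).2 fun x v => ?_
    have h1 := hdom (Fin.append x fun _ => v)
    have h2 := hp (Fin.append x fun _ => v)
    have h3 : t * lin A σ v ≤ form A (block X β (scalarTuple γ)) (Fin.append x fun _ => v) :=
      calc t * lin A σ v ≤ |t| * |lin A σ v| := (le_abs_self _).trans (abs_mul _ _).le
        _ ≤ |t| * (C * form A (block X β (scalarTuple γ)) (Fin.append x fun _ => v)) := by
            rw [hZc] at h1
            exact mul_le_mul_of_nonneg_left h1 (abs_nonneg t)
        _ ≤ 1 * form A (block X β (scalarTuple γ)) (Fin.append x fun _ => v) := by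
            rw [← mul_assoc]
            exact mul_le_mul_of_nonneg_right ht h2
        _ = _ := one_mul _
    rw [form_block_scalarTuple hA] at h3
    rw [lin_add, smul_lin]
    linarith
  set t := (C + 1)⁻¹ with ht
  have ht0 : 0 < t := by positivity
  have htC : |t| * C ≤ 1 := by
    rw [abs_of_pos ht0, ht, inv_mul_le_iff₀ (by positivity)]
    linarith
  have := hγ.2 (hmem t htC) (hmem (-t) (by rwa [abs_neg])) ⟨1 / 2, 1 / 2, by norm_num, by norm_num,
    by norm_num, by module⟩
  rw [add_eq_left, smul_eq_zero] at this
  exact this.resolve_left ht0.ne'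

/-- If `β` extends to a dilation direction at `(X, β, γ)`, then rotating the last two coordinates of
the dilation gives a dilation of `X` along a larger multiple of `β`. -/
lemma dropLast_ne (hA : ∀ i, IsSelfAdjoint (A i)) (hX : X ∈ spectrahedron A n)
    (hY : block X β (scalarTuple γ) ∈ spectrahedron A (n + 1))
    (hmax : IsGreatest {α : ℝ | ∃ γ' : Fin g → ℝ,
      (pencil A (block X (α • β) (scalarTuple γ'))).IsPositive} 1) {b : MatTuple g (n + 1) 1}
    (hb : b ∈ dilationSubspace (spectrahedron A) (block X β (scalarTuple γ))) :
    dropLast b ≠ β := by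
  intro hbβ
  obtain ⟨c, hc, h⟩ := (isDominated_of_mem hA hY hb).exists_block_mem hA hY
  rw [block_mem_iff hA hY.1] at h
  set s := √(1 + c ^ 2) with hs
  have hs2 : s ^ 2 = 1 + c ^ 2 := Real.sq_sqrt (by positivity)
  have hs1 : 1 < s := by
    rw [hs, Real.lt_sqrt (by norm_num)]
    have : 0 < c ^ 2 := by positivity
    linarith
  have hs0 : s ≠ 0 := by positivity
  -- Compress the dilation of `block X β γ` by `c • b` and corner `0` to the unit vector `s⁻¹(1, c)`
  -- in the last two coordinates. The off-diagonal column becomes `s⁻¹β + c s⁻¹ · cβ = sβ`, and the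
  -- new corner is the displayed witness.
  refine absurd (hmax.2 ⟨(s⁻¹ ^ 2) • γ + (2 * c ^ 2 * s⁻¹ ^ 2) • lastRow b, ?_⟩) (not_le.2 hs1)
  rw [pencil_block_isPositive_iff hA hX.1]
  intro x w
  have := h (Fin.append x fun _ => s⁻¹ • w) ((c * s⁻¹) • w)
  rw [form_block_scalarTuple hA, cross_smul, cross_append_const, hbβ, lin_zero, cross_const_smul,
    cross_const_smul, norm_smul, norm_smul, mul_pow, mul_pow, lin_smul, Real.norm_eq_abs,
    Real.norm_eq_abs, sq_abs, sq_abs] at this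
  have e : ∑ i, lastRow b i * inner ℝ (A i ((c * s⁻¹) • w)) (s⁻¹ • w) =
      c * s⁻¹ ^ 2 * lin A (lastRow b) w := by
    simp only [lin, map_smul, real_inner_smul_left, real_inner_smul_right, Finset.mul_sum]
    exact Finset.sum_congr rfl fun i _ => by ring
  rw [e] at this
  rw [lin_add, smul_lin, smul_lin, cross_smul]
  have e1 : s⁻¹ + c * (c * s⁻¹) = s := by
    field_simp
    linarith
  have e2 : s⁻¹ ^ 2 + (c * s⁻¹) ^ 2 = 1 := by
    field_simp
    linarith
  set B := cross A β x fun _ => w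
  calc 0 ≤ _ := this
    _ = form A X x + ((s⁻¹ ^ 2 + (c * s⁻¹) ^ 2) * ‖w‖ ^ 2 - (s⁻¹ ^ 2 * lin A γ w +
          2 * c ^ 2 * s⁻¹ ^ 2 * lin A (lastRow b) w)) - 2 * ((s⁻¹ + c * (c * s⁻¹)) * B) := by ring
    _ = _ := by rw [e1, e2, one_mul]

lemma finrank_dilationSubspace_lt (hA : ∀ i, IsSelfAdjoint (A i))
    (hAc : ∀ i, IsCompactOperator (A i)) (hX : X ∈ spectrahedron A n)
    {Y : MatTuple g (n + 1) (n + 1)} (h : IsMaximalOneDilation A X Y) :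
    Module.finrank ℝ (dilationSubspace (spectrahedron A) Y) <
      Module.finrank ℝ (dilationSubspace (spectrahedron A) X) := by
  obtain ⟨hY, β, γ, rfl, -, hmax, hγ⟩ := h
  set D := dilationSubspace (spectrahedron A) (block X β (scalarTuple γ)) with hD
  have hinj : Function.Injective (dropLast.domRestrict D) := by
    rw [← LinearMap.ker_eq_bot, LinearMap.ker_eq_bot']
    rintro ⟨b, hb⟩ h0
    exact Subtype.ext (eq_zero_of_dropLast_eq_zero h0 (lastRow_eq_zero hA hAc hX hγ hb h0))
  rw [← LinearMap.finrank_range_of_inj hinj]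
  refine Submodule.finrank_lt_finrank_of_lt (lt_of_le_of_ne ?_ ?_)
  · rintro _ ⟨⟨b, hb⟩, rfl⟩
    exact dropLast_mem hA hX hY hb
  · intro heq
    have hβ : β ∈ dilationSubspace (spectrahedron A) X := Submodule.subset_span ⟨γ, hY⟩
    rw [← heq] at hβ
    obtain ⟨⟨b, hb⟩, hbβ⟩ := hβ
    exact dropLast_ne hA hX hY hmax hb hbβ

end Maximal

/-! ### Existence of a maximal 1-dilation. -/

section Existence

variable {X : MatTuple g n n} {β : MatTuple g n 1}

/-- A dilation of `X` that is nontrivial gives a nontrivial dilation by one dimension. -/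
lemma exists_ne_zero_block_mem (hA : ∀ i, IsSelfAdjoint (A i)) (hX : X ∈ spectrahedron A n)
    (hXe : ¬ IsArvesonExtreme (spectrahedron A) X) :
    ∃ β : MatTuple g n 1, β ≠ 0 ∧ ∃ γ, block X β (scalarTuple γ) ∈ spectrahedron A (n + 1) := by
  simp only [IsArvesonExtreme, hX, true_and, not_forall] at hXe
  obtain ⟨l, β, γ, hγ, hmem, hβ⟩ := hXe
  obtain ⟨i, a, c, hne⟩ : ∃ i a c, β i a c ≠ 0 := by
    by_contra! h
    exact hβ (by ext i a c; exact h i a c)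
  refine ⟨fun i => Matrix.of fun a _ => β i a c, fun h => hne ?_, fun i => γ i c c, ?_⟩
  · exact congrFun (congrFun (congrFun h i) a) 0
  · rw [block_mem_iff hA hX.1]
    intro x v
    have := (pencil_isPositive_iff hA hmem.1).1 hmem.2 (Fin.append x (Pi.single c v))
    rw [form_block hA] at this
    have e1 : cross A β x (Pi.single c v) =
        cross A (fun i => Matrix.of fun a (_ : Fin 1) => β i a c) x (fun _ => v) := by
      unfold cross
      refine Finset.sum_congr rfl fun i _ => Finset.sum_congr rfl fun a _ => ?_
      rw [Finset.sum_eq_single c (fun d _ hd => by simp [hd]) (by simp)]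
      simp
    have e2 : form A γ (Pi.single c v) = ‖v‖ ^ 2 - lin A (fun i => γ i c c) v := by
      unfold form cross lin
      congr 1
      · rw [Finset.sum_eq_single c (fun d _ hd => by simp [hd]) (by simp)]
        simp
      · refine Finset.sum_congr rfl fun i _ => ?_
        rw [Finset.sum_eq_single c (fun d _ hd => by simp [hd]) (by simp),
          Finset.sum_eq_single c (fun d _ hd => by simp [hd]) (by simp)]
        simp
    rwa [e1, e2] at this

lemma isCompact_dilations (hA : ∀ i, IsSelfAdjoint (A i))
    (hb : IsBoundedSet (spectrahedron A)) (hX : X ∈ spectrahedron A n) (hβ : β ≠ 0) :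
    IsCompact {p : ℝ × (Fin g → ℝ) |
      (pencil A (block X (p.1 • β) (scalarTuple p.2))).IsPositive} := by
  obtain ⟨C, hC⟩ := hb
  obtain ⟨i₀, a₀, c₀, hne⟩ : ∃ i a c, β i a c ≠ 0 := by
    by_contra! h
    exact hβ (by ext i a c; exact h i a c)
  refine Metric.isCompact_of_isClosed_isBounded ?_ ?_
  · simp only [pencil_block_isPositive_iff hA hX.1, cross_smul, Set.ofPred_forall]
    refine isClosed_iInter fun x => isClosed_iInter fun v => isClosed_le continuous_const ?_
    unfold lin
    fun_prop
  · rw [isBounded_iff_forall_norm_le]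
    -- Every entry of the block is at most `√C` in absolute value; the nonzero entry of `β` turns
    -- this into a bound on `α`, the corner bounds `γ`.
    refine ⟨max (√C / |β i₀ a₀ c₀|) √C, ?_⟩
    rintro ⟨α, γ⟩ h
    have hs : ∀ i, (block X (α • β) (scalarTuple γ) i).IsSymm :=
      fun i => block_isSymm _ i hX.1 (scalarTuple_isSymm γ)
    have hle := sq_apply_le_of_posSemidef hs (hC (n + 1) _ ⟨hs, h⟩)
    refine max_le_max ?_ ((pi_norm_le_iff_of_nonneg (Real.sqrt_nonneg _)).2 fun i => ?_)
    · have := hle i₀ (Fin.castAdd 1 a₀) (Fin.natAdd n c₀)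
      rw [block_castAdd_natAdd] at this
      rw [le_div_iff₀ (abs_pos.2 hne), Real.norm_eq_abs, ← abs_mul]
      exact Real.abs_le_sqrt this
    · have := hle i (Fin.natAdd n 0) (Fin.natAdd n 0)
      rw [block_natAdd_natAdd] at this
      exact Real.abs_le_sqrt this

lemma exists_isMaximalOneDilation (hA : ∀ i, IsSelfAdjoint (A i))
    (hb : IsBoundedSet (spectrahedron A)) (hX : X ∈ spectrahedron A n)
    (hXe : ¬ IsArvesonExtreme (spectrahedron A) X) : ∃ Y, IsMaximalOneDilation A X Y := by
  obtain ⟨β, hβ, γ, hγ⟩ := exists_ne_zero_block_mem hA hX hXe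
  obtain ⟨m, ⟨⟨m, γm⟩, hm, rfl⟩, hmax⟩ :=
    ((isCompact_dilations hA hb hX hβ).image continuous_fst).exists_isGreatest
      ⟨1, (1, γ), by simpa using hγ.2, rfl⟩
  have hm1 : 1 ≤ m := hmax ⟨(1, γ), by simpa using hγ.2, rfl⟩
  have hm0 : 0 < m := by linarith
  have hmβ : m • β ≠ 0 := smul_ne_zero hm0.ne' hβ
  have hsymm : ∀ δ : MatTuple g n 1, ∀ γ i, (block X δ (scalarTuple γ) i).IsSymm :=
    fun δ γ i => block_isSymm _ i hX.1 (scalarTuple_isSymm γ)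
  -- The admissible `γ` form the slice `α = 1` of a compact set, so they have an extreme point by
  -- Krein–Milman.
  have hcomp : IsCompact (gammaSet (spectrahedron A) X (m • β)) := by
    have h1 := (isCompact_dilations hA hb hX hmβ).inter_right
      (isClosed_eq continuous_fst (continuous_const (y := (1 : ℝ))))
    convert h1.image continuous_snd using 1
    ext δ
    constructor
    · intro h
      exact ⟨(1, δ), ⟨by simpa using h.2, rfl⟩, rfl⟩
    · rintro ⟨⟨α, δ⟩, ⟨h, h'⟩, rfl⟩
      obtain rfl : α = 1 := h'
      exact ⟨hsymm _ _, by simpa using h⟩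
  obtain ⟨γe, hγe⟩ := hcomp.extremePoints_nonempty ⟨γm, hsymm _ _, hm⟩
  refine ⟨block X (m • β) (scalarTuple γe), hγe.1, m • β, γe, rfl, hmβ, ⟨⟨γm, ?_⟩, ?_⟩, hγe⟩
  · simpa using hm
  · rintro α ⟨δ, h⟩
    -- A multiple `α` of `m • β` is the multiple `α * m` of `β`, and `m` was the largest one.
    have : α * m ≤ m := hmax ⟨(α * m, δ), by simpa [mul_smul] using h, rfl⟩
    nlinarith

end Existence

end MaximalDilation

end FreeSpec

end

theorem theorem4p6 {H : Type*} [NormedAddCommGroup H] [InnerProductSpace ℝ H] [CompleteSpace H]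
    {g n : ℕ} (A : Fin g → H →L[ℝ] H)
    (hA : ∀ i, IsSelfAdjoint (A i)) (hAc : ∀ i, IsCompactOperator (A i))
    (hb : FreeSpec.IsBoundedSet (FreeSpec.spectrahedron A))
    (X : FreeSpec.MatTuple g n n) (hX : X ∈ FreeSpec.spectrahedron A n)
    (hXe : ¬ FreeSpec.IsArvesonExtreme (FreeSpec.spectrahedron A) X) :
    (∃ Y : FreeSpec.MatTuple g (n + 1) (n + 1), FreeSpec.IsMaximalOneDilation A X Y) ∧
    ∀ Y : FreeSpec.MatTuple g (n + 1) (n + 1), FreeSpec.IsMaximalOneDilation A X Y →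
      Module.finrank ℝ (FreeSpec.dilationSubspace (FreeSpec.spectrahedron A) Y) <
        Module.finrank ℝ (FreeSpec.dilationSubspace (FreeSpec.spectrahedron A) X) :=
  ⟨FreeSpec.exists_isMaximalOneDilation hA hb hX hXe,
    fun _ hY => FreeSpec.finrank_dilationSubspace_lt hA hAc hX hY⟩
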